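/- Let $p$ be an odd prime, $n\ge 1$ and $k\ge 0$ integers, $e=\gcd(n,k)$ (so $e=n$ if $k=0$), $d=(p^k+1)/2$, and let $f(x)=x^d$ on the finite field $\mathbb{F}_{p^n}$ with $p^n$ elements. For $b\in\mathbb{F}_{p^n}$ let $N(1,b)$ be the number of $x\in\mathbb{F}_{p^n}$ with $f(x+1)-f(x)=b$, and for an integer $i\ge 0$ let $\omega_i$ be the number of $b\in\mathbb{F}_{p^n}$ with $N(1,b)=i$. Then the differential spectrum of $f$ is given by the following tables. In each table, if the indices $i$ of several rows coincide (which happens only for $p^e\in\{3,5,9\}$ with $k/e$ odd), then $\omega_i$ is the sum of the values in these rows. 1) Let $k/e$ be odd. 1-i) If $p^e\equiv 3\pmod 4$, then $$\omega_i=\begin{cases}2,& i=\frac{p^e+1}{4},\\ \frac{p^n-p^e}{p^e-1},& i=\frac{p^e-1}{2},\\ \frac{p^n-1}{2},& i=1,\\ \frac{p^n-3}{2}-\frac{p^n-p^e}{p^e-1},& i=0,\\ 0,&\text{otherwise,}\end{cases}$$ where the two $b$ accounting for the first row are $\pm1$; that is, $N(1,1)=N(1,-1)=\frac{p^e+1}{4}$.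 1-ii) If $p^e\equiv 1\pmod 4$, then $$\omega_i=\begin{cases}1,& i=\frac{p^e+3}{4},\\ 1,& i=\frac{p^e-1}{4},\\ \frac{p^n-p^e}{p^e-1},& i=\frac{p^e-1}{2},\\ \frac{p^n-1}{4},& i=2,\\ \frac{(p^n-1)(3p^e-7)}{4(p^e-1)},& i=0,\\ 0,&\text{otherwise,}\end{cases}$$ where the first row is accounted for by $b=1$ and the second by $b=-1$; that is, $N(1,1)=\frac{p^e+3}{4}$ and $N(1,-1)=\frac{p^e-1}{4}$. 2) If $k/e$ is even, then $$\omega_i=\begin{cases}1,& i=p^e,\\ \frac{p^n-p^e}{2(p^e-1)},& i=p^e-1,\\ \frac{p^n-p^e}{2(p^e+1)},& i=p^e+1,\\ p^n-\frac{p^{n+e}-1}{p^{2e}-1},& i=0,\\ 0,&\text{otherwise,}\end{cases}$$ where the first row is accounted for by $b=1$; that is, $N(1,1)=p^e$. -/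

import Mathlib

/-- `N(a, b)`: the number of solutions `x ∈ F` of `f (x + a) - f x = b`. -/
noncomputable def diffCount {F : Type*} [Field F] (f : F → F) (a b : F) : ℕ :=
  Nat.card {x : F // f (x + a) - f x = b}

/-- `ω_i`: the number of `b ∈ F` with `N(1, b) = i`. -/
noncomputable def diffSpectrum {F : Type*} [Field F] (f : F → F) (i : ℕ) : ℕ :=
  Nat.card {b : F // diffCount f 1 b = i}

open Polynomial

/-! Write `q` for the order of `F`, `m = (p ^ k - 1) / 2`, and work in an algebraic closure `K`. Put
`4 x + 2 = s + s⁻¹`; if `s = t ^ 2`, then `x + 1` and `x` are the squares of `(t + t⁻¹) / 2` and `(t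
- t⁻¹) / 2`, and additivity of Frobenius gives `f (x + 1) - f x = (s ^ m + s ^ (-m)) / 2`
(`pow_half_sub_pow_half`). Elements of `F` correspond two-to-one to `s` in the disjoint union of
`μ_(q-1)` and `μ_(q+1)` (`two_mul_card_eq_card_filter_add_inv`).

With `2 b = v + v⁻¹`, the equation becomes `s ^ m = v` or `s ^ m = v⁻¹`. On `μ_(q∓1)` the `m`-th
power map has kernel of order `g = gcd (m, q ∓ 1)` and image `μ_h`, `h = (q ∓ 1) / g`. So away from
`b = ±1` the count is `g₁`, `g₂` or `0`, according to where `v` lies. Parametrising `b` by `v` in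
the same way yields the whole spectrum in terms of the two gcds (`two_mul_diffSpectrum`). These are
computed from `E = p ^ e`, `r = k / e`, `l = n / e` with `r`, `l` coprime. -/

/-! ### Power maps on groups of roots of unity -/

theorem card_nthRootsFinset_one {K : Type*} [Field K] [IsAlgClosed K]
    {d : ℕ} (hd : (d : K) ≠ 0) :
    (nthRootsFinset d (1 : K)).card = d := by
  have : NeZero (d : K) := ⟨hd⟩
  have := IsSepClosed.hasEnoughRootsOfUnity K d
  obtain ⟨ζ, hζ⟩ := HasEnoughRootsOfUnity.exists_primitiveRoot K d
  exact hζ.card_nthRootsFinset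

theorem ne_zero_of_mem_nthRootsFinset {K : Type*} [Field K]
    {d : ℕ} (hd : 0 < d) {s : K}
    (hs : s ∈ nthRootsFinset d (1 : K)) : s ≠ 0 := by
  rintro rfl
  rw [mem_nthRootsFinset hd, zero_pow hd.ne'] at hs
  exact zero_ne_one hs

/-- The `m`-th power map on the `d`-th roots of unity hits exactly the
`d / gcd m d`-th roots of unity. -/
theorem exists_root_pow_eq_iff {K : Type*} [Field K] [IsAlgClosed K]
    {d : ℕ} (m : ℕ) (hd : 0 < d) (v : K) :
    (∃ s : K, s ^ d = 1 ∧ s ^ m = v) ↔ v ^ (d / m.gcd d) = 1 := by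
  have hg : 0 < m.gcd d := Nat.gcd_pos_of_pos_right _ hd
  constructor
  · rintro ⟨s, hs, rfl⟩
    have h : m * (d / m.gcd d) = d * (m / m.gcd d) := by
      rw [← Nat.mul_div_assoc _ (Nat.gcd_dvd_right m d),
        ← Nat.mul_div_assoc _ (Nat.gcd_dvd_left m d), mul_comm]
    rw [← pow_mul, h, pow_mul, hs, one_pow]
  · intro h
    obtain ⟨w, rfl⟩ := IsAlgClosed.exists_pow_nat_eq v hg
    rw [← pow_mul, Nat.mul_div_cancel' (Nat.gcd_dvd_right m d)] at h
    have hw : w ≠ 0 := by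
      rintro rfl
      rw [zero_pow hd.ne'] at h
      exact zero_ne_one h
    -- Bézout: `gcd = m * a + d * b` and `w ^ d = 1`, so `(w ^ a) ^ m = w ^ gcd`.
    refine ⟨w ^ (m.gcdA d), ?_, ?_⟩
    · rw [← zpow_natCast, ← zpow_mul, mul_comm, zpow_mul, zpow_natCast, h, one_zpow]
    · rw [← zpow_natCast w (m.gcd d), Nat.gcd_eq_gcd_ab, zpow_add₀ hw, zpow_mul w (d : ℤ),
        zpow_natCast w d, h, one_zpow, mul_one, ← zpow_natCast, ← zpow_mul, mul_comm]

/-- The fibres of the `m`-th power map on the `d`-th roots of unity. -/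
theorem card_filter_pow_eq {K : Type*} [Field K] [IsAlgClosed K] [DecidableEq K]
    {d : ℕ} (m : ℕ) (hd : (d : K) ≠ 0) (v : K) :
    ((nthRootsFinset d (1 : K)).filter fun s => s ^ m = v).card =
      if v ^ (d / m.gcd d) = 1 then m.gcd d else 0 := by
  have hd0 : 0 < d := Nat.pos_of_ne_zero fun h => hd (by simp [h])
  have hg : 0 < m.gcd d := Nat.gcd_pos_of_pos_right _ hd0
  have hgK : ((m.gcd d : ℕ) : K) ≠ 0 := by
    obtain ⟨c, hc⟩ := Nat.gcd_dvd_right m d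
    intro h
    apply hd
    rw [hc, Nat.cast_mul, h, zero_mul]
  split_ifs with h
  · obtain ⟨s, hs, hsm⟩ := (exists_root_pow_eq_iff m hd0 v).2 h
    have hs0 : s ≠ 0 := ne_zero_of_mem_nthRootsFinset hd0 ((mem_nthRootsFinset hd0 _).2 hs)
    rw [← card_nthRootsFinset_one hgK]
    -- A nonempty fibre is a coset of the kernel, the group of `m.gcd d`-th roots of unity.
    refine Finset.card_bij' (fun t _ => t / s) (fun t _ => t * s) ?_ ?_ ?_ ?_
    · intro t ht
      rw [Finset.mem_filter, mem_nthRootsFinset hd0] at ht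
      have hv : v ≠ 0 := hsm ▸ pow_ne_zero m hs0
      rw [mem_nthRootsFinset hg, pow_gcd_eq_one, div_pow, div_pow, ht.1, ht.2, hs, hsm]
      exact ⟨div_self hv, div_one 1⟩
    · intro t ht
      rw [mem_nthRootsFinset hg, pow_gcd_eq_one] at ht
      rw [Finset.mem_filter, mem_nthRootsFinset hd0, mul_pow, mul_pow, ht.1, ht.2, hs, hsm]
      exact ⟨one_mul 1, one_mul v⟩
    · intro t _
      exact div_mul_cancel₀ t hs0
    · intro t _
      exact mul_div_cancel_right₀ t hs0
  · rw [Finset.card_eq_zero, Finset.filter_eq_empty_iff]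
    intro s hs hsm
    rw [mem_nthRootsFinset hd0] at hs
    exact h ((exists_root_pow_eq_iff m hd0 v).1 ⟨s, hs, hsm⟩)

/-- `v` and `v⁻¹` are the roots of `X ^ 2 - (v + v⁻¹) X + 1`. -/
theorem add_inv_eq_add_inv_iff {K : Type*} [Field K]
    {s v : K} (hs : s ≠ 0) (hv : v ≠ 0) :
    s + s⁻¹ = v + v⁻¹ ↔ s = v ∨ s = v⁻¹ := by
  have key : (s - v) * (s - v⁻¹) = s * (s + s⁻¹ - (v + v⁻¹)) := by
    field_simp
    ring
  rw [← sub_eq_zero, ← sub_eq_zero (a := s) (b := v), ← sub_eq_zero (a := s) (b := v⁻¹),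
    ← mul_eq_zero, key, mul_eq_zero, or_iff_right hs]

/-- The number of `d`-th roots of unity `s` with `s ^ m + s ^ (-m) = v + v⁻¹`. -/
theorem card_filter_pow_add_inv_eq {K : Type*} [Field K] [IsAlgClosed K] [DecidableEq K]
    {d : ℕ} (m : ℕ) (hd : (d : K) ≠ 0) {v : K} (hv : v ≠ 0) :
    ((nthRootsFinset d (1 : K)).filter fun s => s ^ m + (s ^ m)⁻¹ = v + v⁻¹).card =
      (if v = v⁻¹ then 1 else 2) * if v ^ (d / m.gcd d) = 1 then m.gcd d else 0 := by
  have hd0 : 0 < d := Nat.pos_of_ne_zero fun h => hd (by simp [h])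
  have h1 : ((nthRootsFinset d (1 : K)).filter fun s => s ^ m + (s ^ m)⁻¹ = v + v⁻¹) =
      ((nthRootsFinset d (1 : K)).filter fun s => s ^ m = v) ∪
      ((nthRootsFinset d (1 : K)).filter fun s => s ^ m = v⁻¹) := by
    rw [← Finset.filter_or]
    refine Finset.filter_congr fun s hs => ?_
    exact add_inv_eq_add_inv_iff (pow_ne_zero m (ne_zero_of_mem_nthRootsFinset hd0 hs)) hv
  rw [h1]
  by_cases h : v = v⁻¹
  · rw [if_pos h, ← h, Finset.union_self, card_filter_pow_eq m hd, one_mul]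
  · rw [if_neg h, Finset.card_union_of_disjoint, card_filter_pow_eq m hd, card_filter_pow_eq m hd,
      inv_pow, two_mul]
    · simp only [inv_eq_one]
    · rw [Finset.disjoint_filter]
      intro s _ h2 h3
      exact h (h2.symm.trans h3)

/-- Splitting a count over the `d`-th roots of unity into the contributions of `1`, of `-1`, of the
other `h`-th roots of unity and of the rest. -/
theorem card_filter_eq_of_eq_ite {K : Type*} [Field K] [IsAlgClosed K] [DecidableEq K]
    {d h g : ℕ} (hd : (d : K) ≠ 0) (hd2 : Even d) (hhd : h ∣ d)
    (h2 : (2 : K) ≠ 0) (M : K → ℕ)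
    (hM : ∀ v ∈ nthRootsFinset d (1 : K), v ≠ 1 → v ≠ -1 → M v = if v ^ h = 1 then g else 0)
    (i : ℕ) :
    (((nthRootsFinset d (1 : K)).filter fun v => M v = i).card : ℚ) =
      (if i = M 1 then 1 else 0) + (if i = M (-1) then 1 else 0)
      + (if i = g then (h : ℚ) - 1 - (if Even h then 1 else 0) else 0)
      + (if i = 0 then (d : ℚ) - h - 1 + (if Even h then 1 else 0) else 0) := by
  have hd0 : 0 < d := Nat.pos_of_ne_zero fun h => hd (by simp [h])
  have hh0 : 0 < h := Nat.pos_of_dvd_of_pos hhd hd0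
  have hhK : (h : K) ≠ 0 := by
    obtain ⟨c, rfl⟩ := hhd
    intro h'
    apply hd
    rw [Nat.cast_mul, h', zero_mul]
  have hneg : (-1 : K) ≠ 1 := by
    intro h'
    apply h2
    linear_combination -h'
  set A := nthRootsFinset d (1 : K) with hA
  have m1 : (1 : K) ∈ A := by rw [hA, mem_nthRootsFinset hd0, one_pow]
  have m2 : (-1 : K) ∈ A.erase 1 := by
    rw [Finset.mem_erase, hA, mem_nthRootsFinset hd0, hd2.neg_one_pow]
    exact ⟨hneg, rfl⟩
  have hsum : ∀ u : K → ℚ, ∑ v ∈ A, u v = u 1 + u (-1) + ∑ v ∈ (A.erase 1).erase (-1), u v := by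
    intro u
    rw [← Finset.add_sum_erase _ _ m1, ← Finset.add_sum_erase _ _ m2, add_assoc]
  have hc1 : ∑ v ∈ A, (1 : ℚ) = d := by
    rw [Finset.sum_const, hA, card_nthRootsFinset_one hd, nsmul_eq_mul, mul_one]
  have hfil : (A.filter fun v => v ^ h = 1) = nthRootsFinset h (1 : K) := by
    ext v
    rw [Finset.mem_filter, hA, mem_nthRootsFinset hd0, mem_nthRootsFinset hh0]
    refine ⟨fun h' => h'.2, fun h' => ⟨?_, h'⟩⟩
    obtain ⟨c, rfl⟩ := hhd
    rw [pow_mul, h', one_pow]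
  have hc2 : ∑ v ∈ A, (if v ^ h = 1 then (1 : ℚ) else 0) = h := by
    rw [Finset.sum_boole, hfil, card_nthRootsFinset_one hhK]
  have hev : (if (-1 : K) ^ h = 1 then (1 : ℚ) else 0) = if Even h then 1 else 0 := by
    rcases Nat.even_or_odd h with he | ho
    · rw [if_pos he.neg_one_pow, if_pos he]
    · rw [if_neg (by rw [ho.neg_one_pow]; exact hneg), if_neg (Nat.not_even_iff_odd.2 ho)]
  rw [hsum] at hc1 hc2
  rw [hev, one_pow, if_pos rfl] at hc2
  -- Away from `±1`, `M` takes only the values `g` and `0`, so its indicator is affine in that of `v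
  -- ^ h = 1`, even when `i = g = 0`.
  have hrest : ∑ v ∈ (A.erase 1).erase (-1), (if M v = i then (1 : ℚ) else 0) =
      ∑ v ∈ (A.erase 1).erase (-1), ((if i = g then 1 else 0) * (if v ^ h = 1 then (1 : ℚ) else 0)
        + (if i = 0 then 1 else 0) * (1 - (if v ^ h = 1 then (1 : ℚ) else 0))) := by
    refine Finset.sum_congr rfl fun v hv => ?_
    rw [Finset.mem_erase, Finset.mem_erase] at hv
    rw [hM v hv.2.2 hv.2.1 hv.1]
    by_cases hvh : v ^ h = 1 <;> simp [hvh, eq_comm]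
  rw [← Finset.sum_boole, hsum, hrest, Finset.sum_add_distrib, ← Finset.mul_sum, ← Finset.mul_sum,
    Finset.sum_sub_distrib]
  have e1 := eq_sub_of_add_eq' hc1
  have e2 := eq_sub_of_add_eq' hc2
  rw [e1, e2]
  simp only [eq_comm (b := i)]
  by_cases hig : i = g <;> by_cases hi0 : i = 0 <;> simp only [hig, hi0, if_true, if_false] <;>
    split_ifs <;> ring

/-! ### The two-to-one map `s ↦ s + s⁻¹` -/

theorem exists_add_inv_eq {K : Type*} [Field K] [IsAlgClosed K] (h2 : (2 : K) ≠ 0) (y : K) :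
    ∃ s : K, s ≠ 0 ∧ s + s⁻¹ = y := by
  -- `r` is a square root of the discriminant of `s ^ 2 - y s + 1`.
  obtain ⟨r, hr⟩ := IsAlgClosed.exists_eq_mul_self (y ^ 2 - 4)
  have hmul : ((y + r) / 2) * ((y - r) / 2) = 1 := by
    field_simp
    linear_combination hr
  refine ⟨(y + r) / 2, left_ne_zero_of_mul_eq_one hmul, ?_⟩
  rw [inv_eq_of_mul_eq_one_right hmul]
  field_simp
  ring

theorem pow_eq_self_iff_pow_pred_eq_one {F K : Type*} [Fintype F] [Nonempty F] [Field K]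
    {s : K} (hs : s ≠ 0) :
    s ^ Fintype.card F = s ↔ s ^ (Fintype.card F - 1) = 1 := by
  conv_lhs => rw [← Nat.sub_add_cancel (Fintype.card_pos (α := F)), pow_succ]
  rw [mul_eq_right₀ hs]

theorem pow_eq_inv_iff_pow_succ_eq_one {F K : Type*} [Fintype F] [Field K]
    {s : K} (hs : s ≠ 0) :
    s ^ Fintype.card F = s⁻¹ ↔ s ^ (Fintype.card F + 1) = 1 := by
  rw [pow_succ, mul_eq_one_iff_eq_inv₀ hs]

section DoubleCover

variable {F K : Type*} [Field F] [Fintype F] [Field K] [Algebra F K]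

/-- `X ^ q - X` has at most `q` roots, and the image of `F` already supplies `q`. -/
theorem mem_range_algebraMap_of_pow_card_eq {y : K} (h : y ^ Fintype.card F = y) :
    y ∈ Set.range (algebraMap F K) := by
  classical
  have hq : 1 < Fintype.card F := Fintype.one_lt_card
  have hne : (X ^ Fintype.card F - X : K[X]) ≠ 0 := FiniteField.X_pow_card_sub_X_ne_zero K hq
  have hsub : Finset.univ.image (algebraMap F K) ⊆
      (X ^ Fintype.card F - X : K[X]).roots.toFinset := by
    intro z hz
    obtain ⟨a, -, rfl⟩ := Finset.mem_image.1 hz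
    rw [Multiset.mem_toFinset, mem_roots hne, IsRoot.def, eval_sub, eval_pow, eval_X, ← map_pow,
      FiniteField.pow_card, sub_self]
  have hcard : (X ^ Fintype.card F - X : K[X]).roots.toFinset.card ≤
      (Finset.univ.image (algebraMap F K)).card := by
    rw [Finset.card_image_of_injective _ (algebraMap F K).injective, Finset.card_univ]
    calc _ ≤ Multiset.card (X ^ Fintype.card F - X : K[X]).roots := Multiset.toFinset_card_le _
      _ ≤ (X ^ Fintype.card F - X : K[X]).natDegree := card_roots' _
      _ = Fintype.card F := FiniteField.X_pow_card_sub_X_natDegree_eq K hq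
  have hy : y ∈ (X ^ Fintype.card F - X : K[X]).roots.toFinset := by
    rw [Multiset.mem_toFinset, mem_roots hne, IsRoot.def, eval_sub, eval_pow, eval_X, h, sub_self]
  rw [← Finset.eq_of_subset_of_card_le hsub hcard] at hy
  obtain ⟨a, -, rfl⟩ := Finset.mem_image.1 hy
  exact ⟨a, rfl⟩

theorem add_inv_pow_card (s : K) :
    (s + s⁻¹) ^ Fintype.card F = s ^ Fintype.card F + (s ^ Fintype.card F)⁻¹ := by
  obtain ⟨p, hp⟩ := CharP.exists F
  obtain ⟨n, hpp, hn⟩ := FiniteField.card F p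
  have := Fact.mk hpp
  have : CharP K p := charP_of_injective_algebraMap (algebraMap F K).injective p
  rw [hn, add_pow_char_pow, inv_pow]

/-- Being fixed by the `q`-Frobenius means `s ^ q + s ^ (-q) = s + s⁻¹`, that is, `s ^ q` is `s` or
`s⁻¹`. -/
theorem add_inv_mem_range_iff {s : K} (hs : s ≠ 0) :
    s + s⁻¹ ∈ Set.range (algebraMap F K) ↔
      s ^ (Fintype.card F - 1) = 1 ∨ s ^ (Fintype.card F + 1) = 1 := by
  rw [← pow_eq_self_iff_pow_pred_eq_one hs, ← pow_eq_inv_iff_pow_succ_eq_one hs,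
    ← add_inv_eq_add_inv_iff (pow_ne_zero _ hs) hs, ← add_inv_pow_card]
  refine ⟨?_, mem_range_algebraMap_of_pow_card_eq⟩
  rintro ⟨a, ha⟩
  rw [← ha, ← map_pow, FiniteField.pow_card]

variable [IsAlgClosed K] [DecidableEq K]

/-- Every element of `F` has exactly two preimages under `s ↦ s + s⁻¹`, counted over the disjoint
union of the `(q - 1)`-st and the `(q + 1)`-st roots of unity. -/
theorem card_filter_add_inv_eq_add_card_filter (h2 : (2 : K) ≠ 0) (y : F) :
    ((nthRootsFinset (Fintype.card F - 1) (1 : K)).filter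
        fun s => s + s⁻¹ = algebraMap F K y).card +
      ((nthRootsFinset (Fintype.card F + 1) (1 : K)).filter
        fun s => s + s⁻¹ = algebraMap F K y).card = 2 := by
  have hq1 : 0 < Fintype.card F - 1 := Nat.sub_pos_of_lt Fintype.one_lt_card
  have hq2 : 0 < Fintype.card F + 1 := Nat.succ_pos _
  obtain ⟨v, hv, hvy⟩ := exists_add_inv_eq h2 (algebraMap F K y)
  have hfil : ∀ d, 0 < d → ((nthRootsFinset d (1 : K)).filter
      fun s => s + s⁻¹ = algebraMap F K y) = if v ^ d = 1 then {v, v⁻¹} else ∅ := by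
    intro d hd
    ext s
    rw [Finset.mem_filter, mem_nthRootsFinset hd, ← hvy]
    have aux : ∀ s : K, s ≠ 0 → (s + s⁻¹ = v + v⁻¹ ↔ s = v ∨ s = v⁻¹) := fun s hs =>
      add_inv_eq_add_inv_iff hs hv
    constructor
    · rintro ⟨h1, h3⟩
      have hs : s ≠ 0 := by
        rintro rfl
        rw [zero_pow hd.ne'] at h1
        exact zero_ne_one h1
      rcases (aux s hs).1 h3 with rfl | rfl
      · rw [if_pos h1]
        exact Finset.mem_insert_self _ _
      · rw [inv_pow, inv_eq_one] at h1
        rw [if_pos h1]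
        exact Finset.mem_insert_of_mem (Finset.mem_singleton_self _)
    · intro hs
      split_ifs at hs with hvd
      · rw [Finset.mem_insert, Finset.mem_singleton] at hs
        rcases hs with rfl | rfl
        · exact ⟨hvd, rfl⟩
        · exact ⟨by rw [inv_pow, hvd, inv_one], by rw [inv_inv, add_comm]⟩
      · exact absurd hs (Finset.notMem_empty _)
  have hor := (add_inv_mem_range_iff (F := F) hv).1 ⟨y, hvy.symm⟩
  rw [hfil _ hq1, hfil _ hq2]
  -- If `v = v⁻¹`, the single preimage lies in both groups and counts twice; otherwise `v` and `v⁻¹`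
  -- lie together in exactly one group.
  by_cases hvv : v = v⁻¹
  · have h1 := (pow_eq_self_iff_pow_pred_eq_one (F := F) hv)
    have h3 := (pow_eq_inv_iff_pow_succ_eq_one (F := F) hv)
    rw [← hvv] at h3 ⊢
    rw [← h1, ← h3, or_self] at hor
    rw [if_pos (h1.1 hor), if_pos (h3.1 hor), Finset.pair_eq_singleton, Finset.card_singleton]
  · have hnot : ¬ (v ^ (Fintype.card F - 1) = 1 ∧ v ^ (Fintype.card F + 1) = 1) := by
      rw [← pow_eq_self_iff_pow_pred_eq_one hv, ← pow_eq_inv_iff_pow_succ_eq_one hv]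
      rintro ⟨h1, h3⟩
      exact hvv (h1.symm.trans h3)
    have hc : ({v, v⁻¹} : Finset K).card = 2 := Finset.card_pair hvv
    rcases hor with h | h
    · rw [if_pos h, if_neg fun h' => hnot ⟨h, h'⟩, hc, Finset.card_empty]
    · rw [if_pos h, if_neg fun h' => hnot ⟨h', h⟩, hc, Finset.card_empty]

/-- The affine change `a * x + c` permutes `F`, so the two-to-one count applies. It serves both for
solutions (`4 x + 2`) and for values (`2 b`). -/
theorem two_mul_card_eq_card_filter_add_inv (h2 : (2 : K) ≠ 0) (Q : K → Prop) [DecidablePred Q]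
    {a : F} (ha : a ≠ 0) (c : F) :
    2 * Nat.card {x : F // Q (algebraMap F K (a * x + c))} =
      ((nthRootsFinset (Fintype.card F - 1) (1 : K)).filter fun s => Q (s + s⁻¹)).card +
      ((nthRootsFinset (Fintype.card F + 1) (1 : K)).filter fun s => Q (s + s⁻¹)).card := by
  classical
  have hq1 : 0 < Fintype.card F - 1 := Nat.sub_pos_of_lt Fintype.one_lt_card
  have hq2 : 0 < Fintype.card F + 1 := Nat.succ_pos _
  set T : Finset F := Finset.univ.filter fun x => Q (algebraMap F K (a * x + c)) with hT
  have hinj : Function.Injective fun x : F => algebraMap F K (a * x + c) := by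
    intro x y hxy
    have := (algebraMap F K).injective hxy
    exact mul_left_cancel₀ ha (add_right_cancel this)
  have hcount : ∀ d, 0 < d → (∀ s : K, s ^ d = 1 → s + s⁻¹ ∈ Set.range (algebraMap F K)) →
      ((nthRootsFinset d (1 : K)).filter fun s => Q (s + s⁻¹)).card =
        ∑ x ∈ T, ((nthRootsFinset d (1 : K)).filter
          fun s => s + s⁻¹ = algebraMap F K (a * x + c)).card := by
    intro d hd hran
    rw [Finset.card_eq_sum_card_fiberwise (f := fun s : K => s + s⁻¹)
      (t := T.image fun x => algebraMap F K (a * x + c)), Finset.sum_image hinj.injOn]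
    · refine Finset.sum_congr rfl fun x hx => ?_
      rw [Finset.filter_filter]
      congr 1
      refine Finset.filter_congr fun s _ => ?_
      rw [and_iff_right_iff_imp]
      intro hs
      rw [hs]
      exact (Finset.mem_filter.1 hx).2
    · intro s hs
      rw [Finset.mem_coe, Finset.mem_filter, mem_nthRootsFinset hd] at hs
      obtain ⟨y, hy⟩ := hran s hs.1
      have hay : a * ((y - c) / a) + c = y := by
        field_simp
        ring
      refine Finset.mem_coe.2 (Finset.mem_image.2 ⟨(y - c) / a, ?_, ?_⟩)
      · rw [hT, Finset.mem_filter, hay, hy]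
        exact ⟨Finset.mem_univ _, hs.2⟩
      · rw [hay, hy]
  have hne : ∀ d, 0 < d → ∀ s : K, s ^ d = 1 → s ≠ 0 := by
    intro d hd s hs h0
    rw [h0, zero_pow hd.ne'] at hs
    exact zero_ne_one hs
  rw [hcount _ hq1 fun s hs => (add_inv_mem_range_iff (hne _ hq1 s hs)).2 (Or.inl hs),
    hcount _ hq2 fun s hs => (add_inv_mem_range_iff (hne _ hq2 s hs)).2 (Or.inr hs),
    ← Finset.sum_add_distrib,
    Finset.sum_congr rfl fun x _ => card_filter_add_inv_eq_add_card_filter h2 (a * x + c),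
    Finset.sum_const, smul_eq_mul, mul_comm, Nat.card_eq_fintype_card, Fintype.card_subtype]

end DoubleCover

/-! ### Differences of the power function and its spectrum via gcds -/

section PowerDifference

theorem two_ne_zero_of_charP_ne_two {R : Type*} [Ring R] [Nontrivial R] {p : ℕ} [CharP R p]
    (hp2 : p ≠ 2) : (2 : R) ≠ 0 :=
  Ring.two_ne_zero (by rwa [ringChar.eq R p])

theorem four_ne_zero_of_two_ne_zero {R : Type*} [Field R] (h : (2 : R) ≠ 0) : (4 : R) ≠ 0 := by
  have h' : (4 : R) = 2 * 2 := by norm_num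
  rw [h']
  exact mul_ne_zero h h

theorem card_sub_one_cast_ne_zero (F K : Type*) [Field F] [Fintype F] [Field K] [Algebra F K] :
    ((Fintype.card F - 1 : ℕ) : K) ≠ 0 := by
  rw [Nat.cast_sub Fintype.card_pos, ← map_natCast (algebraMap F K),
    FiniteField.cast_card_eq_zero, map_zero]
  simp

theorem card_add_one_cast_ne_zero (F K : Type*) [Field F] [Fintype F] [Field K] [Algebra F K] :
    ((Fintype.card F + 1 : ℕ) : K) ≠ 0 := by
  rw [Nat.cast_add, ← map_natCast (algebraMap F K), FiniteField.cast_card_eq_zero, map_zero]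
  simp

/-- The substitution `4 x + 2 = s + s⁻¹` linearises the difference function of
`x ↦ x ^ ((p ^ k + 1) / 2)`. -/
theorem pow_half_sub_pow_half {K : Type*} [Field K] [IsAlgClosed K] {p : ℕ} [Fact p.Prime]
    [CharP K p] (hp2 : p ≠ 2) (k : ℕ) (h2 : (2 : K) ≠ 0) {s : K} (hs : s ≠ 0) :
    ((s + s⁻¹ - 2) / 4 + 1) ^ ((p ^ k + 1) / 2) - ((s + s⁻¹ - 2) / 4) ^ ((p ^ k + 1) / 2) =
      (s ^ ((p ^ k - 1) / 2) + (s ^ ((p ^ k - 1) / 2))⁻¹) / 2 := by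
  have hodd : Odd (p ^ k) := ((Fact.out : p.Prime).odd_of_ne_two hp2).pow
  obtain ⟨m, hm⟩ := hodd
  have hm1 : (p ^ k + 1) / 2 = m + 1 := by omega
  have hm2 : (p ^ k - 1) / 2 = m := by omega
  rw [hm1, hm2]
  obtain ⟨t, rfl⟩ := IsAlgClosed.exists_eq_mul_self s
  have ht : t ≠ 0 := left_ne_zero_of_mul hs
  have h4 : (4 : K) ≠ 0 := four_ne_zero_of_two_ne_zero h2
  have htwo : (2 : K) ^ p ^ k = 2 := by
    rw [← iterateFrobenius_def, map_ofNat]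
  have hpow : t ^ p ^ k = (t * t) ^ m * t := by
    rw [hm, pow_succ, pow_mul, sq]
  -- On squares the exponent `(p ^ k + 1) / 2` becomes `p ^ k + 1`: a Frobenius power times the
  -- identity.
  have hsq : ∀ a : K, (a ^ 2) ^ (m + 1) = a ^ p ^ k * a := by
    intro a
    rw [← pow_mul, hm, ← pow_succ]
    ring_nf
  have e1 : (t * t + (t * t)⁻¹ - 2) / 4 + 1 = ((t + t⁻¹) / 2) ^ 2 := by
    field_simp
    ring
  have e2 : (t * t + (t * t)⁻¹ - 2) / 4 = ((t - t⁻¹) / 2) ^ 2 := by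
    field_simp
    ring
  rw [e1, e2, hsq, hsq, div_pow, div_pow, add_pow_char_pow, sub_pow_char_pow, htwo, inv_pow, hpow]
  have hu : (t * t) ^ m ≠ 0 := pow_ne_zero m hs
  generalize (t * t) ^ m = u at hu
  field_simp
  ring

variable {F : Type*} [Field F] [Fintype F] {p k : ℕ} {f : F → F}

/-- The number of solutions of `f (x + 1) - f x = b`, where `2 b = v + v⁻¹`. -/
theorem two_mul_diffCount {K : Type*} [Field K] [IsAlgClosed K] [DecidableEq K] [Algebra F K]
    [Fact p.Prime] [CharP F p] (hp2 : p ≠ 2) (hf : ∀ x, f x = x ^ ((p ^ k + 1) / 2))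
    {b : F} {v : K} (hv : v ≠ 0) (hb : algebraMap F K (2 * b) = v + v⁻¹) :
    2 * diffCount f 1 b = (if v = v⁻¹ then 1 else 2) *
      ((if v ^ ((Fintype.card F - 1) / ((p ^ k - 1) / 2).gcd (Fintype.card F - 1)) = 1
          then ((p ^ k - 1) / 2).gcd (Fintype.card F - 1) else 0) +
        (if v ^ ((Fintype.card F + 1) / ((p ^ k - 1) / 2).gcd (Fintype.card F + 1)) = 1
          then ((p ^ k - 1) / 2).gcd (Fintype.card F + 1) else 0)) := by
  have : CharP K p := charP_of_injective_algebraMap (algebraMap F K).injective p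
  have h2 : (2 : K) ≠ 0 := two_ne_zero_of_charP_ne_two hp2
  have h2F : (2 : F) ≠ 0 := two_ne_zero_of_charP_ne_two hp2
  have hq1 : 0 < Fintype.card F - 1 := Nat.sub_pos_of_lt Fintype.one_lt_card
  have hq2 : 0 < Fintype.card F + 1 := Nat.succ_pos _
  have key := two_mul_card_eq_card_filter_add_inv (F := F) h2
    (fun z : K => ((z - 2) / 4 + 1) ^ ((p ^ k + 1) / 2) - ((z - 2) / 4) ^ ((p ^ k + 1) / 2)
      = algebraMap F K b) (four_ne_zero_of_two_ne_zero h2F) 2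
  have hlhs : ∀ x : F, (((algebraMap F K (4 * x + 2) - 2) / 4 + 1) ^ ((p ^ k + 1) / 2) -
      ((algebraMap F K (4 * x + 2) - 2) / 4) ^ ((p ^ k + 1) / 2) = algebraMap F K b) ↔
      f (x + 1) - f x = b := by
    intro x
    have hx : (algebraMap F K (4 * x + 2) - 2) / 4 = algebraMap F K x := by
      rw [map_add, map_mul, map_ofNat, map_ofNat, add_sub_cancel_right, mul_div_cancel_left₀]
      exact four_ne_zero_of_two_ne_zero h2
    rw [hx, hf, hf, ← (algebraMap F K).injective.eq_iff, map_sub, map_pow, map_pow, map_add, map_one]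
  have hrhs : ∀ d, 0 < d → ((nthRootsFinset d (1 : K)).filter fun s : K =>
      ((s + s⁻¹ - 2) / 4 + 1) ^ ((p ^ k + 1) / 2) - ((s + s⁻¹ - 2) / 4) ^ ((p ^ k + 1) / 2)
        = algebraMap F K b) = (nthRootsFinset d (1 : K)).filter fun s =>
        s ^ ((p ^ k - 1) / 2) + (s ^ ((p ^ k - 1) / 2))⁻¹ = v + v⁻¹ := by
    intro d hd
    refine Finset.filter_congr fun s hs => ?_
    rw [pow_half_sub_pow_half hp2 k h2 (ne_zero_of_mem_nthRootsFinset hd hs), ← hb, map_mul,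
      map_ofNat, div_eq_iff h2, mul_comm]
  simp only [hlhs] at key
  rw [hrhs _ hq1, hrhs _ hq2, card_filter_pow_add_inv_eq _ (card_sub_one_cast_ne_zero F K) hv,
    card_filter_pow_add_inv_eq _ (card_add_one_cast_ne_zero F K) hv, ← mul_add] at key
  exact key

variable {g₁ g₂ h₁ h₂ : ℕ}

theorem two_mul_diffCount_of_gcd {K : Type*} [Field K] [IsAlgClosed K] [DecidableEq K]
    [Algebra F K] [Fact p.Prime] [CharP F p] (hp2 : p ≠ 2)
    (hf : ∀ x, f x = x ^ ((p ^ k + 1) / 2))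
    (hg₁ : ((p ^ k - 1) / 2).gcd (Fintype.card F - 1) = g₁) (hh₁ : Fintype.card F - 1 = g₁ * h₁)
    (hg₂ : ((p ^ k - 1) / 2).gcd (Fintype.card F + 1) = g₂) (hh₂ : Fintype.card F + 1 = g₂ * h₂)
    {b : F} {v : K} (hv : v ≠ 0) (hb : algebraMap F K (2 * b) = v + v⁻¹) :
    2 * diffCount f 1 b = (if v = v⁻¹ then 1 else 2) *
      ((if v ^ h₁ = 1 then g₁ else 0) + (if v ^ h₂ = 1 then g₂ else 0)) := by
  have hq1 : 0 < Fintype.card F - 1 := Nat.sub_pos_of_lt Fintype.one_lt_card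
  have hq2 : 0 < Fintype.card F + 1 := Nat.succ_pos _
  have hg₁0 : 0 < g₁ := hg₁ ▸ Nat.gcd_pos_of_pos_right _ hq1
  have hg₂0 : 0 < g₂ := hg₂ ▸ Nat.gcd_pos_of_pos_right _ hq2
  have key := two_mul_diffCount hp2 hf hv hb
  rwa [hg₁, hg₂, Nat.div_eq_of_eq_mul_right hg₁0 hh₁, Nat.div_eq_of_eq_mul_right hg₂0 hh₂] at key

theorem two_mul_diffCount_one [Fact p.Prime] [CharP F p] (hp2 : p ≠ 2)
    (hf : ∀ x, f x = x ^ ((p ^ k + 1) / 2))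
    (hg₁ : ((p ^ k - 1) / 2).gcd (Fintype.card F - 1) = g₁) (hh₁ : Fintype.card F - 1 = g₁ * h₁)
    (hg₂ : ((p ^ k - 1) / 2).gcd (Fintype.card F + 1) = g₂) (hh₂ : Fintype.card F + 1 = g₂ * h₂) :
    2 * diffCount f 1 1 = g₁ + g₂ := by
  classical
  rw [two_mul_diffCount_of_gcd (K := AlgebraicClosure F) hp2 hf hg₁ hh₁ hg₂ hh₂ one_ne_zero
    (by rw [mul_one, map_ofNat, inv_one, one_add_one_eq_two])]
  simp

theorem two_mul_diffCount_neg_one [Fact p.Prime] [CharP F p] (hp2 : p ≠ 2)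
    (hf : ∀ x, f x = x ^ ((p ^ k + 1) / 2))
    (hg₁ : ((p ^ k - 1) / 2).gcd (Fintype.card F - 1) = g₁) (hh₁ : Fintype.card F - 1 = g₁ * h₁)
    (hg₂ : ((p ^ k - 1) / 2).gcd (Fintype.card F + 1) = g₂) (hh₂ : Fintype.card F + 1 = g₂ * h₂) :
    2 * diffCount f 1 (-1) = (if Even h₁ then g₁ else 0) + (if Even h₂ then g₂ else 0) := by
  classical
  let K := AlgebraicClosure F
  have : CharP K p := charP_of_injective_algebraMap (algebraMap F K).injective p
  have h2 : (2 : K) ≠ 0 := two_ne_zero_of_charP_ne_two hp2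
  have hneg : (-1 : K) ≠ 1 := by
    intro h
    apply h2
    linear_combination -h
  have hev : ∀ h : ℕ, (-1 : K) ^ h = 1 ↔ Even h := by
    intro h
    rcases Nat.even_or_odd h with he | ho
    · simp only [he.neg_one_pow, he]
    · simp only [ho.neg_one_pow, hneg, Nat.not_even_iff_odd.2 ho]
  rw [two_mul_diffCount_of_gcd (K := K) hp2 hf hg₁ hh₁ hg₂ hh₂ (neg_ne_zero.2 one_ne_zero)
    (by rw [map_mul, map_neg, map_one, map_ofNat, inv_neg, inv_one]; ring)]
  rw [if_pos (by rw [inv_neg, inv_one]), one_mul]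
  simp only [hev]

/-- The differential spectrum in terms of the greatest common divisors of `(p ^ k - 1) / 2` with
`q - 1` and `q + 1`. -/
theorem two_mul_diffSpectrum [Fact p.Prime] [CharP F p] (hp2 : p ≠ 2)
    (hf : ∀ x, f x = x ^ ((p ^ k + 1) / 2))
    (hg₁ : ((p ^ k - 1) / 2).gcd (Fintype.card F - 1) = g₁) (hh₁ : Fintype.card F - 1 = g₁ * h₁)
    (hg₂ : ((p ^ k - 1) / 2).gcd (Fintype.card F + 1) = g₂) (hh₂ : Fintype.card F + 1 = g₂ * h₂)
    (i : ℕ) :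
    2 * (diffSpectrum f i : ℚ) =
      2 * (if i = diffCount f 1 1 then 1 else 0) + 2 * (if i = diffCount f 1 (-1) then 1 else 0)
      + (if i = g₁ then (h₁ : ℚ) - 1 - (if Even h₁ then 1 else 0) else 0)
      + (if i = 0 then (Fintype.card F : ℚ) - h₁ - 2 + (if Even h₁ then 1 else 0) else 0)
      + (if i = g₂ then (h₂ : ℚ) - 1 - (if Even h₂ then 1 else 0) else 0)
      + (if i = 0 then (Fintype.card F : ℚ) - h₂ + (if Even h₂ then 1 else 0) else 0) := by
  classical
  let K := AlgebraicClosure F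
  have hK : CharP K p := charP_of_injective_algebraMap (algebraMap F K).injective p
  have h2 : (2 : K) ≠ 0 := two_ne_zero_of_charP_ne_two hp2
  have h2F : (2 : F) ≠ 0 := two_ne_zero_of_charP_ne_two hp2
  have hq1 : 0 < Fintype.card F - 1 := Nat.sub_pos_of_lt Fintype.one_lt_card
  have hq2 : 0 < Fintype.card F + 1 := Nat.succ_pos _
  have hqodd : Odd (Fintype.card F) := by
    obtain ⟨n, -, hn⟩ := FiniteField.card F p
    rw [hn]
    exact ((Fact.out : p.Prime).odd_of_ne_two hp2).pow
  have hev1 : Even (Fintype.card F - 1) := Nat.Odd.sub_odd hqodd odd_one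
  have hev2 : Even (Fintype.card F + 1) := hqodd.add_one
  -- The count `N(1, b)` as a function of `z = 2 b` in `K`, so that `z = v + v⁻¹` can be
  -- substituted.
  let N : K → ℕ := fun z => Nat.card {x : F // algebraMap F K (2 * (f (x + 1) - f x)) = z}
  have hN : ∀ b : F, N (algebraMap F K (2 * b)) = diffCount f 1 b := by
    intro b
    have h : ∀ x : F, algebraMap F K (2 * (f (x + 1) - f x)) = algebraMap F K (2 * b) ↔
        f (x + 1) - f x = b := fun x => by
      rw [(algebraMap F K).injective.eq_iff, mul_right_inj' h2F]
    simp only [N, h, diffCount]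
  have hN1 : N (1 + (1 : K)⁻¹) = diffCount f 1 1 := by
    rw [← hN, mul_one, map_ofNat, inv_one, one_add_one_eq_two]
  have hN2 : N (-1 + (-1 : K)⁻¹) = diffCount f 1 (-1) := by
    rw [← hN, map_mul, map_neg, map_one, map_ofNat, inv_neg, inv_one]
    congr 1
    ring
  have hval : ∀ v : K, v ≠ 0 → v ≠ 1 → v ≠ -1 →
      (v ^ (Fintype.card F - 1) = 1 ∨ v ^ (Fintype.card F + 1) = 1) →
      N (v + v⁻¹) = (if v ^ h₁ = 1 then g₁ else 0) + (if v ^ h₂ = 1 then g₂ else 0) := by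
    intro v hv hv1 hv2 hvq
    obtain ⟨y, hy⟩ := (add_inv_mem_range_iff (F := F) hv).2 hvq
    have hb : algebraMap F K (2 * (y / 2)) = v + v⁻¹ := by rw [mul_div_cancel₀ _ h2F, hy]
    have hvv : v ≠ v⁻¹ := by
      intro h
      rcases mul_self_eq_one_iff.1 ((mul_eq_one_iff_eq_inv₀ hv).2 h) with h' | h'
      · exact hv1 h'
      · exact hv2 h'
    have key := two_mul_diffCount_of_gcd hp2 hf hg₁ hh₁ hg₂ hh₂ hv hb
    rw [if_neg hvv] at key
    rw [← hb, hN]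
    exact Nat.eq_of_mul_eq_mul_left two_pos key
  -- The groups `μ_(q-1)` and `μ_(q+1)` meet only in `±1`, so elsewhere just one summand of `hval`
  -- survives.
  have hnot : ∀ v : K, v ≠ 0 → v ≠ 1 → v ≠ -1 → v ^ (Fintype.card F - 1) = 1 →
      v ^ (Fintype.card F + 1) ≠ 1 := by
    intro v hv hv1 hv2 h h'
    rw [← pow_eq_self_iff_pow_pred_eq_one hv] at h
    rw [← pow_eq_inv_iff_pow_succ_eq_one hv, h, ← mul_eq_one_iff_eq_inv₀ hv,
      mul_self_eq_one_iff] at h'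
    exact h'.elim hv1 hv2
  have c1 := card_filter_eq_of_eq_ite (g := g₁) (card_sub_one_cast_ne_zero F K) hev1
    (Dvd.intro_left g₁ hh₁.symm) h2 (fun v => N (v + v⁻¹)) (by
      intro v hvA hv1 hv2
      have hv := ne_zero_of_mem_nthRootsFinset hq1 hvA
      rw [mem_nthRootsFinset hq1] at hvA
      rw [hval v hv hv1 hv2 (Or.inl hvA), if_neg (c := v ^ h₂ = 1), add_zero]
      intro h
      apply hnot v hv hv1 hv2 hvA
      rw [hh₂, mul_comm, pow_mul, h, one_pow]) i
  have c2 := card_filter_eq_of_eq_ite (g := g₂) (card_add_one_cast_ne_zero F K) hev2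
    (Dvd.intro_left g₂ hh₂.symm) h2 (fun v => N (v + v⁻¹)) (by
      intro v hvA hv1 hv2
      have hv := ne_zero_of_mem_nthRootsFinset hq2 hvA
      rw [mem_nthRootsFinset hq2] at hvA
      rw [hval v hv hv1 hv2 (Or.inr hvA), if_neg (c := v ^ h₁ = 1), zero_add]
      intro h
      apply hnot v hv hv1 hv2 _ hvA
      rw [hh₁, mul_comm, pow_mul, h, one_pow]) i
  -- Here it is `b` that is parametrised, by `2 b = v + v⁻¹`; `v = ±1` occur in both groups.
  have key := two_mul_card_eq_card_filter_add_inv (F := F) h2 (fun z : K => N z = i) h2F 0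
  simp only [add_zero, hN] at key
  rw [← diffSpectrum] at key
  have keyQ := congrArg (Nat.cast (R := ℚ)) key
  rw [Nat.cast_mul, Nat.cast_ofNat, Nat.cast_add, c1, c2, hN1, hN2, Nat.cast_sub Fintype.card_pos,
    Nat.cast_add, Nat.cast_one] at keyQ
  rw [keyQ]
  have r1 : (Fintype.card F : ℚ) - 1 - h₁ - 1 = (Fintype.card F : ℚ) - h₁ - 2 := by ring
  have r2 : (Fintype.card F : ℚ) + 1 - h₂ - 1 = (Fintype.card F : ℚ) - h₂ := by ring
  rw [r1, r2]
  ring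

end PowerDifference

/-! ### The greatest common divisors -/

/-- With `E = 2 c + 1`, `E ^ 2 - 1 = 4 c (c + 1)` divides `E ^ (l - 1) - 1`. This form shows the
parity of the quotients of `E ^ l ∓ 1` by `E ∓ 1`. -/
theorem exists_odd_pow_eq (c : ℕ) {l : ℕ} (hl : Odd l) :
    ∃ w : ℕ, (2 * c + 1) ^ l = (2 * c + 1) * (1 + 4 * c * (c + 1) * w) := by
  obtain ⟨j, rfl⟩ := hl
  obtain ⟨w, hw⟩ := Nat.sub_one_dvd_pow_sub_one ((2 * c + 1) ^ 2) j
  have h1 : (2 * c + 1) ^ 2 - 1 = 4 * c * (c + 1) :=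
    Nat.sub_eq_of_eq_add (by ring)
  have h2 : 1 ≤ ((2 * c + 1) ^ 2) ^ j := Nat.one_le_pow _ _ (by positivity)
  refine ⟨w, ?_⟩
  rw [h1] at hw
  rw [pow_succ, pow_mul, mul_comm, ← hw, Nat.add_sub_cancel' h2]

section Gcd

variable {E l r : ℕ}

/-- `E ^ l + 1` divides `E ^ (2 l) - 1`, and `gcd (r, 2 l) = gcd (r, 2)`. -/
theorem gcd_pow_sub_one_pow_add_one_dvd (h : r.Coprime l) :
    (E ^ r - 1).gcd (E ^ l + 1) ∣ E ^ r.gcd 2 - 1 := by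
  have h2 : r.gcd (l * 2) = r.gcd 2 := h.symm.gcd_mul_left_cancel_right 2
  rw [← h2, ← Nat.pow_sub_one_gcd_pow_sub_one]
  refine Nat.dvd_gcd (Nat.gcd_dvd_left _ _) ((Nat.gcd_dvd_right _ _).trans ?_)
  rw [pow_mul, show (E ^ l) ^ 2 - 1 = (E ^ l) ^ 2 - 1 ^ 2 by rw [one_pow], Nat.sq_sub_sq]
  exact Dvd.intro _ rfl

/-- `E ^ r - 1 = (E - 1) u` with `u` odd, so halving removes one factor `2` from the gcd `E - 1` of
the unhalved numbers. -/
theorem half_gcd_pow_sub_one_of_odd (hE : Odd E) (hE1 : 1 < E) (hr : Odd r) (h : r.Coprime l) :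
    ((E ^ r - 1) / 2).gcd (E ^ l - 1) = (E - 1) / 2 := by
  obtain ⟨c, rfl⟩ := hE
  obtain ⟨w, hw⟩ := exists_odd_pow_eq c hr
  have hc : 0 < c := by omega
  have hg := Nat.pow_sub_one_gcd_pow_sub_one (2 * c + 1) r l
  obtain ⟨c', hc'⟩ := Nat.sub_one_dvd_pow_sub_one (2 * c + 1) l
  have hP : (2 * c + 1) ^ r - 1 = 2 * c * (1 + 2 * ((2 * c + 1) * (c + 1) * w)) := by
    rw [hw]
    exact Nat.sub_eq_of_eq_add (by ring)
  rw [h.gcd_eq_one, pow_one, Nat.add_sub_cancel] at hg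
  rw [Nat.add_sub_cancel] at hc' ⊢
  rw [hP, hc'] at hg ⊢
  rw [Nat.gcd_mul_left, mul_eq_left₀ (by omega)] at hg
  have hu : (1 + 2 * ((2 * c + 1) * (c + 1) * w)).Coprime (2 * c') :=
    Nat.Coprime.mul_right (by simp) hg
  generalize 1 + 2 * ((2 * c + 1) * (c + 1) * w) = u at hu
  rw [mul_assoc, Nat.mul_div_cancel_left _ two_pos, mul_comm 2 c, mul_assoc c 2 c',
    Nat.gcd_mul_left, hu.gcd_eq_one, mul_one, Nat.mul_div_cancel _ two_pos]

/-- The gcd divides both `E ^ l - 1` and `E ^ l + 1`, hence `2`; with `E = 2 c + 1`, the number `(E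
^ r - 1) / 2` is `c` times an odd number. -/
theorem half_gcd_pow_add_one_of_odd (hE : Odd E) (hr : Odd r) (h : r.Coprime l) :
    ((E ^ r - 1) / 2).gcd (E ^ l + 1) = if E % 4 = 3 then 1 else 2 := by
  have hdvd2 : ((E ^ r - 1) / 2).gcd (E ^ l + 1) ∣ 2 := by
    have hd := gcd_pow_sub_one_pow_add_one_dvd (E := E) h
    rw [(Nat.coprime_two_right.2 hr).gcd_eq_one, pow_one] at hd
    have hq := hd.trans (Nat.sub_one_dvd_pow_sub_one E l)
    have h1 : 1 ≤ E ^ l := Nat.one_le_pow _ _ hE.pos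
    have : (E ^ r - 1).gcd (E ^ l + 1) ∣ 2 := by
      have := Nat.dvd_sub (Nat.gcd_dvd_right (E ^ r - 1) (E ^ l + 1)) hq
      rwa [show E ^ l + 1 - (E ^ l - 1) = 2 by omega] at this
    refine (Nat.gcd_dvd_gcd_of_dvd_left _ ?_).trans this
    obtain ⟨a, ha⟩ := hE.pow (n := r)
    exact Nat.div_dvd_of_dvd ⟨a, by omega⟩
  obtain ⟨b, hb⟩ := hE.pow (n := l)
  obtain ⟨c, rfl⟩ := hE
  obtain ⟨w, hw⟩ := exists_odd_pow_eq c hr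
  have hP : ((2 * c + 1) ^ r - 1) / 2 = c * (1 + 2 * ((2 * c + 1) * (c + 1) * w)) := by
    rw [hw]
    apply Nat.div_eq_of_eq_mul_right two_pos
    exact Nat.sub_eq_of_eq_add (by ring)
  have hodd : Odd (1 + 2 * ((2 * c + 1) * (c + 1) * w)) := ⟨_, add_comm _ _⟩
  rcases (Nat.dvd_prime Nat.prime_two).1 hdvd2 with h1 | h2
  · rw [h1, if_pos]
    by_contra hcon
    have hce : 2 ∣ c := by omega
    have : 2 ∣ 1 := by
      rw [← h1]
      refine Nat.dvd_gcd ?_ ⟨b + 1, by omega⟩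
      rw [hP]
      exact hce.mul_right _
    omega
  · rw [h2, if_neg]
    intro hcon
    have hco : Odd c := by
      rw [Nat.odd_iff]
      omega
    have h3 : 2 ∣ ((2 * c + 1) ^ r - 1) / 2 := by
      conv_lhs => rw [← h2]
      exact Nat.gcd_dvd_left _ _
    rw [hP] at h3
    exact (Nat.not_even_iff_odd.2 (hco.mul hodd)) (even_iff_two_dvd.2 h3)

theorem pow_sub_one_half_dvd_of_even (hr : Even r) (c : ℕ) :
    2 * c * (c + 1) ∣ ((2 * c + 1) ^ r - 1) / 2 := by
  obtain ⟨j, rfl⟩ := hr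
  obtain ⟨w, hw⟩ := Nat.sub_one_dvd_pow_sub_one ((2 * c + 1) ^ 2) j
  have h1 : (2 * c + 1) ^ 2 - 1 = 4 * c * (c + 1) :=
    Nat.sub_eq_of_eq_add (by ring)
  rw [← two_mul, pow_mul, hw, h1]
  refine ⟨w, Nat.div_eq_of_eq_mul_right two_pos (by ring)⟩

/-- For even `r` halving costs nothing: `(E ^ 2 - 1) / 2`, a multiple of `E - 1`, divides `(E ^ r -
1) / 2`. -/
theorem half_gcd_pow_sub_one_of_even (hE : Odd E) (hr : Even r) (h : r.Coprime l) :
    ((E ^ r - 1) / 2).gcd (E ^ l - 1) = E - 1 := by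
  apply Nat.dvd_antisymm
  · have hg := Nat.pow_sub_one_gcd_pow_sub_one E r l
    rw [h.gcd_eq_one, pow_one] at hg
    rw [← hg]
    obtain ⟨a, ha⟩ := hE.pow (n := r)
    exact Nat.gcd_dvd_gcd_of_dvd_left _ (Nat.div_dvd_of_dvd ⟨a, by omega⟩)
  · refine Nat.dvd_gcd ?_ (Nat.sub_one_dvd_pow_sub_one E l)
    obtain ⟨c, rfl⟩ := hE
    exact (Dvd.intro _ rfl).trans (pow_sub_one_half_dvd_of_even hr c)

/-- The gcd divides `E ^ 2 - 1`, and `E ^ l + 1` is congruent to `E + 1` modulo `E ^ 2 - 1` because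
`l` is odd. -/
theorem half_gcd_pow_add_one_of_even (hE : Odd E) (hr : Even r) (h : r.Coprime l) :
    ((E ^ r - 1) / 2).gcd (E ^ l + 1) = E + 1 := by
  have hl : Odd l := by
    rw [← Nat.not_even_iff_odd]
    intro hl
    exact Nat.not_coprime_of_dvd_of_dvd one_lt_two hr.two_dvd hl.two_dvd h
  have hd := gcd_pow_sub_one_pow_add_one_dvd (E := E) h
  rw [Nat.gcd_eq_right hr.two_dvd] at hd
  obtain ⟨a, ha⟩ := hE.pow (n := r)
  have hd1 : ((E ^ r - 1) / 2).gcd (E ^ l + 1) ∣ E ^ 2 - 1 :=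
    (Nat.gcd_dvd_gcd_of_dvd_left _ (Nat.div_dvd_of_dvd ⟨a, by omega⟩)).trans hd
  have hd2 := Nat.gcd_dvd_right ((E ^ r - 1) / 2) (E ^ l + 1)
  obtain ⟨c, rfl⟩ := hE
  obtain ⟨w, hw⟩ := exists_odd_pow_eq c hl
  apply Nat.dvd_antisymm
  · have h1 : (2 * c + 1) ^ 2 - 1 = 4 * c * (c + 1) :=
      Nat.sub_eq_of_eq_add (by ring)
    rw [h1] at hd1
    have h3 : (2 * c + 1) ^ l + 1 =
        (4 * c * (c + 1)) * ((2 * c + 1) * w) + (2 * c + 1 + 1) := by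
      rw [hw]
      ring
    rw [h3] at hd1 hd2 ⊢
    exact (Nat.dvd_add_right (hd1.mul_right _)).1 hd2
  · refine Nat.dvd_gcd ?_ ⟨1 + 2 * c * (2 * c + 1) * w, by rw [hw]; ring⟩
    exact Dvd.dvd.trans ⟨c, by ring⟩ (pow_sub_one_half_dvd_of_even hr c)

end Gcd

/-! ### Assembling the tables -/

/-- Makes the tables linear in formal indicators, so coinciding row indices need no case split. -/
theorem exists_indicator (i : ℕ) :
    ∃ I : ℕ → ℚ, ∀ (j : ℕ) (x : ℚ), (if i = j then x else 0) = x * I j :=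
  ⟨fun j => if i = j then 1 else 0, fun _ _ => by rw [mul_ite, mul_one, mul_zero]⟩

section Assembly

variable {F : Type*} [Field F] [Finite F] {p n k e l r : ℕ} {f : F → F}

theorem charP_of_natCard_eq_prime_pow [Fact p.Prime] (hF : Nat.card F = p ^ n) : CharP F p := by
  have := Fintype.ofFinite F
  rw [Nat.card_eq_fintype_card] at hF
  exact charP_of_card_eq_prime_pow hF

/-- Here `g₁ = (E - 1) / 2`, `g₂ = 1` and both cofactors are even, so `1` and `-1` each receive `(g₁
+ g₂) / 2`. -/
theorem diffSpectrum_of_odd_of_mod_four_eq_three (hp : p.Prime) (hp2 : p ≠ 2) (he : e ≠ 0)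
    (hl : n = e * l) (hrk : k = e * r) (hrl : r.Coprime l) (hF : Nat.card F = p ^ n)
    (hf : ∀ x, f x = x ^ ((p ^ k + 1) / 2)) (hr : Odd r) (h4 : p ^ e % 4 = 3) :
    (∀ i : ℕ, (diffSpectrum f i : ℚ) =
        (if i = (p ^ e + 1) / 4 then 2 else 0)
      + (if i = (p ^ e - 1) / 2 then ((p : ℚ) ^ n - p ^ e) / (p ^ e - 1) else 0)
      + (if i = 1 then ((p : ℚ) ^ n - 1) / 2 else 0)
      + (if i = 0 then ((p : ℚ) ^ n - 3) / 2 - ((p : ℚ) ^ n - p ^ e) / (p ^ e - 1) else 0)) ∧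
    diffCount f 1 1 = (p ^ e + 1) / 4 ∧
    diffCount f 1 (-1) = (p ^ e + 1) / 4 := by
  have := Fact.mk hp
  have := Fintype.ofFinite F
  have := charP_of_natCard_eq_prime_pow hF
  rw [Nat.card_eq_fintype_card] at hF
  have hE : Odd (p ^ e) := (hp.odd_of_ne_two hp2).pow
  have hE1 : 1 < p ^ e := Nat.one_lt_pow he hp.one_lt
  have hqE : p ^ n = (p ^ e) ^ l := by rw [hl, pow_mul]
  have hPE : p ^ k = (p ^ e) ^ r := by rw [hrk, pow_mul]
  have hq0 : 0 < p ^ n := Nat.pow_pos hp.pos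
  have hg₁ : ((p ^ k - 1) / 2).gcd (Fintype.card F - 1) = (p ^ e - 1) / 2 := by
    rw [hF, hqE, hPE, half_gcd_pow_sub_one_of_odd hE hE1 hr hrl]
  have hg₂ : ((p ^ k - 1) / 2).gcd (Fintype.card F + 1) = 1 := by
    rw [hF, hqE, hPE, half_gcd_pow_add_one_of_odd hE hr hrl, if_pos h4]
  obtain ⟨c, hc⟩ := Nat.sub_one_dvd_pow_sub_one (p ^ e) l
  rw [← hqE] at hc
  have hh₁ : Fintype.card F - 1 = (p ^ e - 1) / 2 * (2 * c) := by
    rw [hF, hc, ← mul_assoc, Nat.div_mul_cancel (by omega)]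
  have hh₂ : Fintype.card F + 1 = 1 * (Fintype.card F + 1) := (one_mul _).symm
  have hev₁ : Even (2 * c) := even_two_mul c
  have hev₂ : Even (Fintype.card F + 1) := by
    rw [hF]
    exact ((hp.odd_of_ne_two hp2).pow).add_one
  have hN1 := two_mul_diffCount_one hp2 hf hg₁ hh₁ hg₂ hh₂
  have hN2 := two_mul_diffCount_neg_one hp2 hf hg₁ hh₁ hg₂ hh₂
  rw [if_pos hev₁, if_pos hev₂] at hN2
  have hN1' : diffCount f 1 1 = (p ^ e + 1) / 4 := by omega
  have hN2' : diffCount f 1 (-1) = (p ^ e + 1) / 4 := by omega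
  refine ⟨fun i => ?_, hN1', hN2'⟩
  have key := two_mul_diffSpectrum hp2 hf hg₁ hh₁ hg₂ hh₂ i
  rw [if_pos hev₁, if_pos hev₂, hN1', hN2', Nat.cast_add, Nat.cast_mul, hF] at key
  push_cast at key
  have hEQ : (p : ℚ) ^ e - 1 ≠ 0 := by
    have : (1 : ℚ) < (p : ℚ) ^ e := by exact_mod_cast hE1
    exact (sub_pos.2 this).ne'
  have hcQ : (p : ℚ) ^ n - 1 = ((p : ℚ) ^ e - 1) * c := by
    have := congrArg (Nat.cast (R := ℚ)) hc
    rw [Nat.cast_mul, Nat.cast_sub hq0, Nat.cast_sub hE1.le] at this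
    exact_mod_cast this
  have hdiv : ((p : ℚ) ^ n - p ^ e) / (p ^ e - 1) = c - 1 := by
    rw [div_eq_iff hEQ]
    linear_combination hcQ
  rw [hdiv]
  obtain ⟨I, hI⟩ := exists_indicator i
  simp only [hI] at key ⊢
  linear_combination key / 2

/-- Here `g₂ = 2`, and `h₂ = (q + 1) / 2` is odd as `q ≡ 1` modulo `4`; so `b = -1` loses the
contribution of `g₂`. -/
theorem diffSpectrum_of_odd_of_mod_four_eq_one (hp : p.Prime) (hp2 : p ≠ 2) (he : e ≠ 0)
    (hl : n = e * l) (hrk : k = e * r) (hrl : r.Coprime l) (hF : Nat.card F = p ^ n)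
    (hf : ∀ x, f x = x ^ ((p ^ k + 1) / 2)) (hr : Odd r) (h4 : p ^ e % 4 = 1) :
    (∀ i : ℕ, (diffSpectrum f i : ℚ) =
        (if i = (p ^ e + 3) / 4 then 1 else 0)
      + (if i = (p ^ e - 1) / 4 then 1 else 0)
      + (if i = (p ^ e - 1) / 2 then ((p : ℚ) ^ n - p ^ e) / (p ^ e - 1) else 0)
      + (if i = 2 then ((p : ℚ) ^ n - 1) / 4 else 0)
      + (if i = 0 then
          (((p : ℚ) ^ n - 1) * (3 * (p : ℚ) ^ e - 7)) / (4 * ((p : ℚ) ^ e - 1)) else 0)) ∧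
    diffCount f 1 1 = (p ^ e + 3) / 4 ∧
    diffCount f 1 (-1) = (p ^ e - 1) / 4 := by
  have := Fact.mk hp
  have := Fintype.ofFinite F
  have := charP_of_natCard_eq_prime_pow hF
  rw [Nat.card_eq_fintype_card] at hF
  have hE : Odd (p ^ e) := (hp.odd_of_ne_two hp2).pow
  have hE1 : 1 < p ^ e := Nat.one_lt_pow he hp.one_lt
  have hqE : p ^ n = (p ^ e) ^ l := by rw [hl, pow_mul]
  have hPE : p ^ k = (p ^ e) ^ r := by rw [hrk, pow_mul]
  have hq0 : 0 < p ^ n := Nat.pow_pos hp.pos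
  have hg₁ : ((p ^ k - 1) / 2).gcd (Fintype.card F - 1) = (p ^ e - 1) / 2 := by
    rw [hF, hqE, hPE, half_gcd_pow_sub_one_of_odd hE hE1 hr hrl]
  have hg₂ : ((p ^ k - 1) / 2).gcd (Fintype.card F + 1) = 2 := by
    rw [hF, hqE, hPE, half_gcd_pow_add_one_of_odd hE hr hrl, if_neg (by omega)]
  have hq4 : p ^ n % 4 = 1 := by
    rw [hqE, Nat.pow_mod, h4, one_pow, Nat.mod_eq_of_lt (by norm_num)]
  obtain ⟨c, hc⟩ := Nat.sub_one_dvd_pow_sub_one (p ^ e) l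
  rw [← hqE] at hc
  have hh₁ : Fintype.card F - 1 = (p ^ e - 1) / 2 * (2 * c) := by
    rw [hF, hc, ← mul_assoc, Nat.div_mul_cancel (by omega)]
  obtain ⟨h, hh⟩ : ∃ h, p ^ n + 1 = 2 * h := ⟨(p ^ n + 1) / 2, by omega⟩
  have hh₂ : Fintype.card F + 1 = 2 * h := by rw [hF, hh]
  have hev₁ : Even (2 * c) := even_two_mul c
  have hev₂ : ¬ Even h := by
    rw [Nat.not_even_iff]
    omega
  have hN1 := two_mul_diffCount_one hp2 hf hg₁ hh₁ hg₂ hh₂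
  have hN2 := two_mul_diffCount_neg_one hp2 hf hg₁ hh₁ hg₂ hh₂
  rw [if_pos hev₁, if_neg hev₂] at hN2
  have hN1' : diffCount f 1 1 = (p ^ e + 3) / 4 := by omega
  have hN2' : diffCount f 1 (-1) = (p ^ e - 1) / 4 := by omega
  refine ⟨fun i => ?_, hN1', hN2'⟩
  have key := two_mul_diffSpectrum hp2 hf hg₁ hh₁ hg₂ hh₂ i
  rw [if_pos hev₁, if_neg hev₂, hN1', hN2', Nat.cast_mul, hF] at key
  push_cast at key
  have hEQ : (p : ℚ) ^ e - 1 ≠ 0 := by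
    have : (1 : ℚ) < (p : ℚ) ^ e := by exact_mod_cast hE1
    exact (sub_pos.2 this).ne'
  have hcQ : (p : ℚ) ^ n - 1 = ((p : ℚ) ^ e - 1) * c := by
    have := congrArg (Nat.cast (R := ℚ)) hc
    rw [Nat.cast_mul, Nat.cast_sub hq0, Nat.cast_sub hE1.le] at this
    exact_mod_cast this
  have hhQ : (h : ℚ) = ((p : ℚ) ^ n + 1) / 2 := by
    rw [eq_div_iff two_ne_zero, mul_comm]
    exact_mod_cast hh.symm
  rw [hhQ] at key
  have hdiv : ((p : ℚ) ^ n - p ^ e) / (p ^ e - 1) = c - 1 := by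
    rw [div_eq_iff hEQ]
    linear_combination hcQ
  have hdiv0 : (((p : ℚ) ^ n - 1) * (3 * (p : ℚ) ^ e - 7)) / (4 * ((p : ℚ) ^ e - 1)) =
      3 * ((p : ℚ) ^ n - 1) / 4 - c := by
    rw [div_eq_iff (mul_ne_zero four_ne_zero hEQ)]
    linear_combination -4 * hcQ
  rw [hdiv, hdiv0]
  obtain ⟨I, hI⟩ := exists_indicator i
  simp only [hI] at key ⊢
  linear_combination key / 2

theorem diffSpectrum_of_even (hp : p.Prime) (hp2 : p ≠ 2) (he : e ≠ 0)
    (hl : n = e * l) (hrk : k = e * r) (hrl : r.Coprime l) (hF : Nat.card F = p ^ n)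
    (hf : ∀ x, f x = x ^ ((p ^ k + 1) / 2)) (hr : Even r) :
    (∀ i : ℕ, (diffSpectrum f i : ℚ) =
        (if i = p ^ e then 1 else 0)
      + (if i = p ^ e - 1 then ((p : ℚ) ^ n - p ^ e) / (2 * (p ^ e - 1)) else 0)
      + (if i = p ^ e + 1 then ((p : ℚ) ^ n - p ^ e) / (2 * (p ^ e + 1)) else 0)
      + (if i = 0 then
          (p : ℚ) ^ n - ((p : ℚ) ^ (n + e) - 1) / ((p : ℚ) ^ (2 * e) - 1) else 0)) ∧
    diffCount f 1 1 = p ^ e := by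
  have := Fact.mk hp
  have := Fintype.ofFinite F
  have := charP_of_natCard_eq_prime_pow hF
  rw [Nat.card_eq_fintype_card] at hF
  have hE : Odd (p ^ e) := (hp.odd_of_ne_two hp2).pow
  have hE1 : 1 < p ^ e := Nat.one_lt_pow he hp.one_lt
  have hqE : p ^ n = (p ^ e) ^ l := by rw [hl, pow_mul]
  have hPE : p ^ k = (p ^ e) ^ r := by rw [hrk, pow_mul]
  have hq0 : 0 < p ^ n := Nat.pow_pos hp.pos
  have hlodd : Odd l := by
    rw [← Nat.not_even_iff_odd]
    intro hl
    exact Nat.not_coprime_of_dvd_of_dvd one_lt_two hr.two_dvd hl.two_dvd hrl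
  have hg₁ : ((p ^ k - 1) / 2).gcd (Fintype.card F - 1) = p ^ e - 1 := by
    rw [hF, hqE, hPE, half_gcd_pow_sub_one_of_even hE hr hrl]
  have hg₂ : ((p ^ k - 1) / 2).gcd (Fintype.card F + 1) = p ^ e + 1 := by
    rw [hF, hqE, hPE, half_gcd_pow_add_one_of_even hE hr hrl]
  obtain ⟨h₁, hh₁, hodd₁⟩ : ∃ h₁, p ^ n - 1 = (p ^ e - 1) * h₁ ∧ ¬ Even h₁ := by
    obtain ⟨c, hc⟩ := hE
    obtain ⟨w, hw⟩ := exists_odd_pow_eq c hlodd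
    refine ⟨1 + 2 * ((2 * c + 1) * (c + 1) * w), ?_, ?_⟩
    · rw [hqE, hc, hw, Nat.add_sub_cancel]
      exact Nat.sub_eq_of_eq_add (by ring)
    · exact Nat.not_even_iff_odd.2 ⟨_, add_comm _ _⟩
  obtain ⟨h₂, hh₂, hodd₂⟩ : ∃ h₂, p ^ n + 1 = (p ^ e + 1) * h₂ ∧ ¬ Even h₂ := by
    obtain ⟨c, hc⟩ := hE
    obtain ⟨w, hw⟩ := exists_odd_pow_eq c hlodd
    refine ⟨1 + 2 * ((2 * c + 1) * c * w), ?_, ?_⟩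
    · rw [hqE, hc, hw]
      ring
    · exact Nat.not_even_iff_odd.2 ⟨_, add_comm _ _⟩
  have hN1 := two_mul_diffCount_one hp2 hf hg₁ (by rw [hF, hh₁]) hg₂ (by rw [hF, hh₂])
  have hN2 := two_mul_diffCount_neg_one hp2 hf hg₁ (by rw [hF, hh₁]) hg₂ (by rw [hF, hh₂])
  rw [if_neg hodd₁, if_neg hodd₂] at hN2
  have hN1' : diffCount f 1 1 = p ^ e := by omega
  -- Both cofactors are odd, so `b = -1` has no solutions and joins the row `i = 0`.
  have hN2' : diffCount f 1 (-1) = 0 := by omega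
  refine ⟨fun i => ?_, hN1'⟩
  have key := two_mul_diffSpectrum hp2 hf hg₁ (by rw [hF, hh₁]) hg₂ (by rw [hF, hh₂]) i
  rw [if_neg hodd₁, if_neg hodd₂, hN1', hN2', hF] at key
  push_cast at key
  have hE1Q : (1 : ℚ) < (p : ℚ) ^ e := by exact_mod_cast hE1
  have hEQ : (p : ℚ) ^ e - 1 ≠ 0 := (sub_pos.2 hE1Q).ne'
  have hEQ' : (p : ℚ) ^ e + 1 ≠ 0 := by linarith
  have hQ₁ : (p : ℚ) ^ n - 1 = ((p : ℚ) ^ e - 1) * h₁ := by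
    have := congrArg (Nat.cast (R := ℚ)) hh₁
    rw [Nat.cast_mul, Nat.cast_sub hq0, Nat.cast_sub hE1.le] at this
    exact_mod_cast this
  have hQ₂ : (p : ℚ) ^ n + 1 = ((p : ℚ) ^ e + 1) * h₂ := by exact_mod_cast hh₂
  have hdiv₁ : ((p : ℚ) ^ n - p ^ e) / (2 * (p ^ e - 1)) = (h₁ - 1) / 2 := by
    rw [div_eq_iff (mul_ne_zero two_ne_zero hEQ)]
    linear_combination hQ₁
  have hdiv₂ : ((p : ℚ) ^ n - p ^ e) / (2 * (p ^ e + 1)) = (h₂ - 1) / 2 := by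
    rw [div_eq_iff (mul_ne_zero two_ne_zero hEQ')]
    linear_combination hQ₂
  have hdiv₀ : ((p : ℚ) ^ (n + e) - 1) / ((p : ℚ) ^ (2 * e) - 1) = (h₁ + h₂) / 2 := by
    have hsq : (p : ℚ) ^ (2 * e) - 1 = (p ^ e - 1) * (p ^ e + 1) := by ring
    rw [hsq, div_eq_iff (mul_ne_zero hEQ hEQ'), pow_add]
    linear_combination ((p : ℚ) ^ e + 1) / 2 * hQ₁ + ((p : ℚ) ^ e - 1) / 2 * hQ₂
  rw [hdiv₁, hdiv₂, hdiv₀]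
  obtain ⟨I, hI⟩ := exists_indicator i
  simp only [hI] at key ⊢
  linear_combination key / 2

end Assembly

theorem mainTheorem1 (p n k e : ℕ) (hp : p.Prime) (hp2 : p ≠ 2) (he : e = Nat.gcd n k)
    {F : Type*} [Field F] [Finite F] (hF : Nat.card F = p ^ n)
    (f : F → F) (hf : ∀ x, f x = x ^ ((p ^ k + 1) / 2)) :
    (Odd (k / e) → p ^ e % 4 = 3 →
      (∀ i : ℕ, (diffSpectrum f i : ℚ) =
          (if i = (p ^ e + 1) / 4 then 2 else 0)
        + (if i = (p ^ e - 1) / 2 then ((p : ℚ) ^ n - p ^ e) / (p ^ e - 1) else 0)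
        + (if i = 1 then ((p : ℚ) ^ n - 1) / 2 else 0)
        + (if i = 0 then ((p : ℚ) ^ n - 3) / 2 - ((p : ℚ) ^ n - p ^ e) / (p ^ e - 1) else 0)) ∧
      diffCount f 1 1 = (p ^ e + 1) / 4 ∧
      diffCount f 1 (-1) = (p ^ e + 1) / 4) ∧
    (Odd (k / e) → p ^ e % 4 = 1 →
      (∀ i : ℕ, (diffSpectrum f i : ℚ) =
          (if i = (p ^ e + 3) / 4 then 1 else 0)
        + (if i = (p ^ e - 1) / 4 then 1 else 0)
        + (if i = (p ^ e - 1) / 2 then ((p : ℚ) ^ n - p ^ e) / (p ^ e - 1) else 0)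
        + (if i = 2 then ((p : ℚ) ^ n - 1) / 4 else 0)
        + (if i = 0 then
            (((p : ℚ) ^ n - 1) * (3 * (p : ℚ) ^ e - 7)) / (4 * ((p : ℚ) ^ e - 1)) else 0)) ∧
      diffCount f 1 1 = (p ^ e + 3) / 4 ∧
      diffCount f 1 (-1) = (p ^ e - 1) / 4) ∧
    (Even (k / e) →
      (∀ i : ℕ, (diffSpectrum f i : ℚ) =
          (if i = p ^ e then 1 else 0)
        + (if i = p ^ e - 1 then ((p : ℚ) ^ n - p ^ e) / (2 * (p ^ e - 1)) else 0)
        + (if i = p ^ e + 1 then ((p : ℚ) ^ n - p ^ e) / (2 * (p ^ e + 1)) else 0)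
        + (if i = 0 then
            (p : ℚ) ^ n - ((p : ℚ) ^ (n + e) - 1) / ((p : ℚ) ^ (2 * e) - 1) else 0)) ∧
      diffCount f 1 1 = p ^ e) := by
  have hn : n ≠ 0 := by
    rintro rfl
    rw [pow_zero] at hF
    exact (Finite.one_lt_card (α := F)).ne' hF
  have he0 : 0 < e := he ▸ Nat.gcd_pos_of_pos_left k (Nat.pos_of_ne_zero hn)
  obtain ⟨l, hl⟩ : e ∣ n := he ▸ Nat.gcd_dvd_left n k
  -- For `k = 0` this gives `e = n`, `l = 1`, `r = 0`, which falls under the even case.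
  obtain ⟨r, hr⟩ : e ∣ k := he ▸ Nat.gcd_dvd_right n k
  have hrl : r.Coprime l := by
    have h : e * l.gcd r = e * 1 := by rw [← Nat.gcd_mul_left, ← hl, ← hr, ← he, mul_one]
    exact Nat.Coprime.symm (Nat.eq_of_mul_eq_mul_left he0 h)
  have hdiv : k / e = r := by rw [hr, Nat.mul_div_cancel_left _ he0]
  rw [hdiv]
  exact ⟨diffSpectrum_of_odd_of_mod_four_eq_three hp hp2 he0.ne' hl hr hrl hF hf,
    diffSpectrum_of_odd_of_mod_four_eq_one hp hp2 he0.ne' hl hr hrl hF hf,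
    diffSpectrum_of_even hp hp2 he0.ne' hl hr hrl hF hf⟩
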